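/- Let $k$ be a commutative ring and $\mathcal C$ an essentially small category. Left (right) $\mathcal C$-modules are functors from $\mathcal C$ (from $\mathcal C^{op}$) to $k$-modules. Let $T:\mathcal C^{op}\times\mathcal C\to k\text{-mod}$ be a Yoneda bifunctor: a bifunctor with a surjection $\mu: k[\mathrm{Hom}_{\mathcal C}(-,-)]\to T$ such that, writing $T_a=T(a,-)$, for all $a,b$ the map $\mathrm{Hom}(T_b,T_a)\to T(a,b)$, $N\mapsto N_b(\mu(1_b))$, is bijective. Then $T^{op}(a,b)=T(b,a)$ is a Yoneda bifunctor for $\mathcal C^{op}$. Let $\mathcal C_T\text{-mod}$ be the smallest full subcategory of left $\mathcal C$-modules that contains all $T_a$ and is stable under limits and colimits; it is an abelian category with enough projectives. Let $D:(\mathcal C_T\text{-mod})^{op}\to\mathcal C_{T^{op}}\text{-mod}$ be the functor $DF(x)=\mathrm{Hom}(F,T_x)$, let $RD:\mathcal D^-(\mathcal C_T\text{-mod})^{op}\to\mathcal D^+(\mathcal C_{T^{op}}\text{-mod})$ be its derived functor, and put $D^n(F)=H^n(RD(F))$. An object of $\mathcal C_T\text{-mod}$ is of finite type if it is a quotient of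 a finite direct sum of modules $T_a$, and is of type $FP$ if it has a finite resolution by projectives of finite type of $\mathcal C_T\text{-mod}$. An object $F$ of type $FP$ is a duality functor if there is an integer $m$ with $RD(F)\cong D^m(F)[m]$ in $\mathcal D^+(\mathcal C_{T^{op}}\text{-mod})$, where $X[m]$ denotes the complex with $X$ in degree $m$ and zero elsewhere. The dualizing functor of a duality functor $F$ of projective dimension $n$ in $\mathcal C_T\text{-mod}$ is $D^n(F)$. **Proposition.** Let $F$ be a duality functor in $\mathcal C_T\text{-mod}$ of projective dimension $n$. Then $D^n(F)$ is a duality functor in $\mathcal C_{T^{op}}\text{-mod}$, of projective dimension $n$, and its dualizing functor is $F$, i.e. $D^n(D^n(F))\cong F$ (the outer $D^n$ being formed with respect to $T^{op}$, and $(\mathcal C^{op})^{op}$ being identified with $\mathcal C$). -/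

import Mathlib

open CategoryTheory CategoryTheory.Limits Opposite

universe w u

noncomputable section

/-- The bifunctor `(x, y) ↦ k[Hom(x, y)]`, contravariant in `x` and covariant in `y`. -/
abbrev freeHom (C : Type u) [Category.{w} C] (k : Type w) [CommRing k] :
    Cᵒᵖ ⥤ C ⥤ ModuleCat.{w} k :=
  coyoneda ⋙ (Functor.whiskeringRight C (Type w) (ModuleCat.{w} k)).obj (ModuleCat.free k)

/-- A Yoneda bifunctor for `C` over `k`: a quotient `μ : k[Hom(-,-)] ↠ T` such that
`N ↦ N_b(μ(1_b))` is a bijection `Hom(T_b, T_a) ≃ T(a, b)` for all `a`, `b`,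
where `T_a = T(a, -)`. -/
structure YonedaBifunctor (C : Type u) [Category.{w} C] (k : Type w) [CommRing k] where
  bifunctor : Cᵒᵖ ⥤ C ⥤ ModuleCat.{w} k
  μ : freeHom C k ⟶ bifunctor
  μ_surjective : ∀ (a : Cᵒᵖ) (b : C), Function.Surjective ((μ.app a).app b)
  bijective : ∀ a b : C, Function.Bijective
    (fun N : bifunctor.obj (op b) ⟶ bifunctor.obj (op a) =>
      N.app b ((μ.app (op b)).app b (ModuleCat.freeMk (𝟙 b))))

section LinearAction

variable {C : Type u} [Category.{w} C] {k : Type w} [CommRing k]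

/-- The action of a formal linear combination of morphisms `a ⟶ b` through a functor `G`
with values in a `k`-linear category. -/
def linAct {E : Type*} [Category* E] [Preadditive E] [Linear k E] (G : C ⥤ E) {a b : C} :
    ((a ⟶ b) →₀ k) →ₗ[k] (G.obj a ⟶ G.obj b) :=
  Finsupp.linearCombination k (fun f : a ⟶ b => G.map f)

@[simp]
lemma linAct_single {E : Type*} [Category* E] [Preadditive E] [Linear k E] (G : C ⥤ E) {a b : C}
    (f : a ⟶ b) (r : k) : linAct G (Finsupp.single f r) = r • G.map f := by
  simp [linAct]

lemma linAct_naturality {E : Type*} [Category* E] [Preadditive E] [Linear k E] {G H : C ⥤ E}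
    (N : G ⟶ H) {a b : C} (p : (a ⟶ b) →₀ k) :
    linAct G p ≫ N.app b = N.app a ≫ linAct H p := by
  induction p using Finsupp.induction_linear with
  | zero => simp
  | add p q hp hq => simp [hp, hq]
  | single f r => simp

end LinearAction

section Quotients

variable {C : Type u} [Category.{w} C] {k : Type w} [CommRing k]
  {B : Cᵒᵖ ⥤ C ⥤ ModuleCat.{w} k} (μ : freeHom C k ⟶ B)

/-- The image in `B(a, b)` of a formal linear combination of morphisms `a ⟶ b`. -/
def quotMap (a b : C) : ((a ⟶ b) →₀ k) →ₗ[k] (B.obj (op a)).obj b :=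
  ((μ.app (op a)).app b).hom

lemma quotMap_covariant {c a b : C} (g : c ⟶ a) (f : a ⟶ b) :
    ((B.obj (op c)).map f).hom (quotMap μ c a (Finsupp.single g 1)) =
      quotMap μ c b (Finsupp.single (g ≫ f) 1) := by
  have h := congr($((μ.app (op c)).naturality f).hom (ModuleCat.freeMk g))
  have h2 : (((freeHom C k).obj (op c)).map f).hom (ModuleCat.freeMk g) =
      ModuleCat.freeMk (g ≫ f) := ModuleCat.free_map_apply _ _
  refine Eq.trans h.symm ?_
  exact congrArg ((μ.app (op c)).app b).hom h2

lemma quotMap_contravariant {c a b : C} (g : c ⟶ a) (f : a ⟶ b) :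
    ((B.map g.op).app b).hom (quotMap μ a b (Finsupp.single f 1)) =
      quotMap μ c b (Finsupp.single (g ≫ f) 1) := by
  have h := congr($(congr_app (μ.naturality g.op) b).hom (ModuleCat.freeMk f))
  have h2 : (((freeHom C k).map g.op).app b).hom (ModuleCat.freeMk f) =
      ModuleCat.freeMk (g ≫ f) := ModuleCat.free_map_apply _ _
  refine Eq.trans h.symm ?_
  exact congrArg ((μ.app (op c)).app b).hom h2


lemma linAct_quotMap {c a b : C} (p : (a ⟶ b) →₀ k) (g : c ⟶ a) :
    (linAct (B.obj (op c)) p).hom (quotMap μ c a (Finsupp.single g 1)) =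
      ((B.map g.op).app b).hom (quotMap μ a b p) := by
  induction p using Finsupp.induction_linear with
  | zero => simp
  | add p q hp hq => simp [hp, hq]
  | single f r =>
    have h : (Finsupp.single f r : (a ⟶ b) →₀ k) = r • Finsupp.single f 1 := by simp
    rw [h, map_smul, map_smul, map_smul, linAct_single, one_smul, quotMap_contravariant,
      ← quotMap_covariant]
    rfl

lemma linAct_app_quotMap {x y : Cᵒᵖ} (p : (x ⟶ y) →₀ k) :
    ((linAct B p).app (unop x)).hom (quotMap μ (unop x) (unop x) (Finsupp.single (𝟙 _) 1)) =
      quotMap μ (unop y) (unop x) (Finsupp.lmapDomain k k (fun f => f.unop) p) := by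
  induction p using Finsupp.induction_linear with
  | zero => simp
  | add p q hp hq => rw [map_add, map_add, map_add, ← hp, ← hq]; rfl
  | single f r =>
    have h : (Finsupp.single f r : (x ⟶ y) →₀ k) = r • Finsupp.single f 1 := by simp
    rw [h, map_smul, map_smul, map_smul, linAct_single, one_smul, Finsupp.lmapDomain_apply,
      Finsupp.mapDomain_single]
    have := quotMap_contravariant μ f.unop (𝟙 _)
    rw [Category.comp_id] at this
    rw [← this]
    rfl

lemma hom_quotMap {a b : C} {F : C ⥤ ModuleCat.{w} k} (N : B.obj (op a) ⟶ F)
    (p : (a ⟶ b) →₀ k) :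
    (N.app b).hom (quotMap μ a b p) =
      (linAct F p).hom ((N.app a).hom (quotMap μ a a (Finsupp.single (𝟙 a) 1))) := by
  have h := congr($(linAct_naturality N p).hom (quotMap μ a a (Finsupp.single (𝟙 a) 1)))
  refine Eq.trans ?_ h
  have h2 := linAct_quotMap μ p (𝟙 a)
  rw [op_id, B.map_id] at h2
  exact (congrArg (N.app b).hom h2).symm

/-- A morphism out of `B_a` is determined by the image of the class of the identity. -/
lemma hom_ext_of_quot (hμ : ∀ (a b : C), Function.Surjective (quotMap μ a b))
    {a : C} {F : C ⥤ ModuleCat.{w} k} {N N' : B.obj (op a) ⟶ F}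
    (h : (N.app a).hom (quotMap μ a a (Finsupp.single (𝟙 a) 1)) =
      (N'.app a).hom (quotMap μ a a (Finsupp.single (𝟙 a) 1))) : N = N' := by
  ext b x
  obtain ⟨p, rfl⟩ := hμ a b x
  exact (hom_quotMap μ N p).trans ((congrArg _ h).trans (hom_quotMap μ N' p).symm)

lemma bijective_of_quot (hμ : ∀ (a b : C), Function.Surjective (quotMap μ a b)) (a b : C) :
    Function.Bijective (fun N : B.obj (op b) ⟶ B.obj (op a) =>
      N.app b ((μ.app (op b)).app b (ModuleCat.freeMk (𝟙 b)))) := by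
  refine ⟨fun N N' h => hom_ext_of_quot μ hμ h, fun x => ?_⟩
  obtain ⟨p, rfl⟩ := hμ a b x
  refine ⟨linAct B (a := op b) (b := op a) (Finsupp.lmapDomain k k (fun f => f.op) p), ?_⟩
  refine (linAct_app_quotMap μ (x := op b) (y := op a) _).trans ?_
  congr 1
  simp only [Finsupp.lmapDomain_apply, ← Finsupp.mapDomain_comp]
  exact Finsupp.mapDomain_id

end Quotients

section ShrinkMap

universe v₁ v₂ v₃

variable {k : Type w} [CommRing k] {A : Type v₁} {B : Type v₂} {D : Type v₃}
  [AddCommGroup A] [Module k A] [AddCommGroup B] [Module k B] [AddCommGroup D] [Module k D]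
  [Small.{w} A] [Small.{w} B] [Small.{w} D]

/-- The morphism between `w`-small models induced by a linear map. -/
def shrinkMap (l : A →ₗ[k] B) :
    ModuleCat.of k (Shrink.{w} A) ⟶ ModuleCat.of k (Shrink.{w} B) :=
  ModuleCat.ofHom ((Shrink.linearEquiv k B).symm.toLinearMap ∘ₗ l ∘ₗ
    (Shrink.linearEquiv k A).toLinearMap)

lemma shrinkMap_hom_apply (l : A →ₗ[k] B) (x : Shrink.{w} A) :
    (shrinkMap l).hom x = (Shrink.linearEquiv k B).symm (l (Shrink.linearEquiv k A x)) := rfl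

lemma shrinkMap_eq_id {l : A →ₗ[k] A} (h : ∀ x, l x = x) : shrinkMap.{w} l = 𝟙 _ :=
  ModuleCat.hom_ext <| LinearMap.ext fun x => by
    refine (shrinkMap_hom_apply l x).trans ?_
    rw [h, LinearEquiv.symm_apply_apply]
    rfl

lemma shrinkMap_comp (l : A →ₗ[k] B) (l' : B →ₗ[k] D) :
    shrinkMap.{w} l ≫ shrinkMap.{w} l' = shrinkMap.{w} (l' ∘ₗ l) :=
  ModuleCat.hom_ext <| LinearMap.ext fun x => by
    refine (congrArg (shrinkMap l').hom (shrinkMap_hom_apply l x)).trans ?_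
    refine (shrinkMap_hom_apply _ _).trans (Eq.trans ?_ (shrinkMap_hom_apply _ _).symm)
    rw [LinearEquiv.apply_symm_apply]
    rfl

lemma shrinkMap_add (l l' : A →ₗ[k] B) :
    shrinkMap.{w} (l + l') = shrinkMap.{w} l + shrinkMap.{w} l' :=
  ModuleCat.hom_ext <| LinearMap.ext fun x =>
    map_add (Shrink.linearEquiv k B).symm (l (Shrink.linearEquiv k A x))
      (l' (Shrink.linearEquiv k A x))

lemma shrinkMap_smul (r : k) (l : A →ₗ[k] B) :
    shrinkMap.{w} (r • l) = r • shrinkMap.{w} l :=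
  ModuleCat.hom_ext <| LinearMap.ext fun x =>
    map_smul (Shrink.linearEquiv k B).symm r (l (Shrink.linearEquiv k A x))

lemma shrinkMap_zero : shrinkMap.{w} (0 : A →ₗ[k] B) = 0 := by
  simpa using shrinkMap_smul (0 : k) (0 : A →ₗ[k] B)

end ShrinkMap

namespace YonedaBifunctor

variable {C : Type u} [Category.{w} C] {k : Type w} [CommRing k] (T : YonedaBifunctor C k)

/-- The `T`-standard left module `T_a = T(a, -)`. -/
abbrev std (a : C) : C ⥤ ModuleCat.{w} k := T.bifunctor.obj (op a)

lemma quotMap_surjective (a b : C) : Function.Surjective (quotMap T.μ a b) :=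
  T.μ_surjective (Opposite.op a) b

/-- The surjection `k[Hom(-,-)] ↠ T` viewed for the opposite category. -/
def opμ : freeHom Cᵒᵖ k ⟶ unopUnop C ⋙ T.bifunctor.flip where
  app X :=
    { app := fun y => ModuleCat.ofHom ((quotMap T.μ y.unop X.unop.unop).comp
        (Finsupp.lmapDomain k k (fun f : X.unop ⟶ y => f.unop)))
      naturality := by
        intro y z f
        refine ModuleCat.free_hom_ext fun g => ?_
        have h := quotMap_contravariant T.μ f.unop g.unop
        refine Eq.trans ?_ (Eq.trans h.symm ?_)
        · refine congrArg (quotMap T.μ z.unop X.unop.unop) ?_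
          refine (congrArg _ (ModuleCat.free_map_apply _ g)).trans ?_
          exact Finsupp.mapDomain_single
        · refine congrArg ((T.bifunctor.map f).app X.unop.unop).hom ?_
          refine congrArg (quotMap T.μ y.unop X.unop.unop) ?_
          exact Finsupp.mapDomain_single.symm }
  naturality := by
    intro X Y g
    ext y : 2
    refine ModuleCat.free_hom_ext fun f => ?_
    have h := quotMap_covariant T.μ f.unop g.unop.unop
    refine Eq.trans ?_ (Eq.trans h.symm ?_)
    · refine congrArg (quotMap T.μ y.unop Y.unop.unop) ?_
      refine (congrArg _ (ModuleCat.free_map_apply _ f)).trans ?_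
      exact Finsupp.mapDomain_single
    · refine congrArg ((T.bifunctor.obj y).map g.unop.unop).hom ?_
      refine congrArg (quotMap T.μ y.unop X.unop.unop) ?_
      exact Finsupp.mapDomain_single.symm

lemma opμ_surjective (a b : Cᵒᵖ) : Function.Surjective (quotMap T.opμ a b) := by
  intro x
  obtain ⟨p, rfl⟩ := T.quotMap_surjective b.unop a.unop x
  refine ⟨Finsupp.lmapDomain k k (fun f => f.op) p, ?_⟩
  refine congrArg (quotMap T.μ b.unop a.unop) ?_
  simp only [Finsupp.lmapDomain_apply, ← Finsupp.mapDomain_comp]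
  exact Finsupp.mapDomain_id

/-- The opposite Yoneda bifunctor `(a, b) ↦ T(b, a)` for `Cᵒᵖ`. -/
def op : YonedaBifunctor Cᵒᵖ k where
  bifunctor := unopUnop C ⋙ T.bifunctor.flip
  μ := T.opμ
  μ_surjective a b := T.opμ_surjective a.unop b
  bijective := bijective_of_quot T.opμ T.opμ_surjective

/-- Annihilation by the kernel of `μ : k[Hom(-,-)] ↠ T`; `modProp_iff` below shows that this
characterizes the objects of `C_T-mod`. -/
def IsKilled (F : C ⥤ ModuleCat.{w} k) : Prop :=
  ∀ ⦃a b : C⦄ (p : (a ⟶ b) →₀ k), quotMap T.μ a b p = 0 → linAct F p = 0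

/-- The objects of the smallest full subcategory of the category of left `C`-modules which
contains the modules `T_a` and is stable under small limits and colimits. -/
def modProp : ObjectProperty (C ⥤ ModuleCat.{w} k) := fun F =>
  ∀ Q : ObjectProperty (C ⥤ ModuleCat.{w} k),
    (∀ a : C, Q (T.std a)) →
    (∀ (J : Type w) [SmallCategory J], Q.IsClosedUnderLimitsOfShape J) →
    (∀ (J : Type w) [SmallCategory J], Q.IsClosedUnderColimitsOfShape J) →
    Q F

lemma modProp_std (a : C) : T.modProp (T.std a) := fun _ h _ _ => h a

instance (J : Type w) [SmallCategory J] : T.modProp.IsClosedUnderColimitsOfShape J where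
  colimitsOfShape_le := by
    rintro F ⟨h⟩ Q h1 h2 h3
    exact (h3 J).colimitsOfShape_le _ ⟨h.ofLE fun G hG => hG Q h1 h2 h3⟩

instance (J : Type w) [SmallCategory J] : T.modProp.IsClosedUnderLimitsOfShape J where
  limitsOfShape_le := by
    rintro F ⟨h⟩ Q h1 h2 h3
    exact (h2 J).limitsOfShape_le _ ⟨h.ofLE fun G hG => hG Q h1 h2 h3⟩

lemma isKilled_std (a : C) : T.IsKilled (T.std a) := by
  intro x y p hp
  ext z
  obtain ⟨q, rfl⟩ := T.quotMap_surjective a x z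
  induction q using Finsupp.induction_linear with
  | zero => simp
  | add p q hp hq => rw [map_add, map_add, map_add, hp, hq]
  | single f r =>
    have h : (Finsupp.single f r : (a ⟶ x) →₀ k) = r • Finsupp.single f 1 := by simp
    rw [h, map_smul, map_smul, map_smul, linAct_quotMap, hp]
    simp

instance : ObjectProperty.IsClosedUnderSubobjects T.IsKilled where
  prop_of_mono {X Y} f _ hY a b p hp := by
    rw [← cancel_mono (f.app b), linAct_naturality, hY p hp]
    simp

instance : ObjectProperty.IsClosedUnderQuotients T.IsKilled where
  prop_of_epi {X Y} f _ hX a b p hp := by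
    rw [← cancel_epi (f.app a), ← linAct_naturality, hX p hp]
    simp

instance (J : Type w) [SmallCategory J] : ObjectProperty.IsClosedUnderLimitsOfShape T.IsKilled J where
  limitsOfShape_le := by
    rintro F ⟨h⟩ a b p hp
    refine (isLimitOfPreserves ((evaluation C _).obj b) h.isLimit).hom_ext fun j => ?_
    have := h.prop_diag_obj j p hp
    have h2 := linAct_naturality (h.π.app j) p
    rw [this] at h2
    exact h2.trans (by simp)

instance (J : Type w) [SmallCategory J] :
    ObjectProperty.IsClosedUnderColimitsOfShape T.IsKilled J where
  colimitsOfShape_le := by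
    rintro F ⟨h⟩ a b p hp
    refine (isColimitOfPreserves ((evaluation C _).obj a) h.isColimit).hom_ext fun j => ?_
    have := h.prop_diag_obj j p hp
    have h2 := linAct_naturality (h.ι.app j) p
    rw [this] at h2
    exact h2.symm.trans (by simp)

lemma isKilled_of_modProp {F : C ⥤ ModuleCat.{w} k} (hF : T.modProp F) : T.IsKilled F :=
  hF T.IsKilled T.isKilled_std inferInstance inferInstance

lemma linAct_eq_of_isKilled {F : C ⥤ ModuleCat.{w} k} (hF : T.IsKilled F) {a b : C}
    {p q : (a ⟶ b) →₀ k} (h : quotMap T.μ a b p = quotMap T.μ a b q) :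
    linAct F p = linAct F q := by
  rw [← sub_eq_zero, ← map_sub]
  exact hF _ (by rw [map_sub, h, sub_self])

lemma linAct_map {F : C ⥤ ModuleCat.{w} k} {a b c : C} (p : (a ⟶ b) →₀ k) (g : b ⟶ c) :
    linAct F p ≫ F.map g = linAct F (Finsupp.lmapDomain k k (fun f => f ≫ g) p) := by
  induction p using Finsupp.induction_linear with
  | zero => simp
  | add p q hp hq => rw [map_add, map_add, map_add, Preadditive.add_comp, hp, hq]
  | single f r => simp

lemma quotMap_map {a b c : C} (p : (a ⟶ b) →₀ k) (g : b ⟶ c) :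
    ((T.std a).map g).hom (quotMap T.μ a b p) =
      quotMap T.μ a c (Finsupp.lmapDomain k k (fun f => f ≫ g) p) := by
  induction p using Finsupp.induction_linear with
  | zero => simp
  | add p q hp hq => rw [map_add, map_add, map_add, map_add, hp, hq]
  | single f r =>
    have h : (Finsupp.single f r : (a ⟶ b) →₀ k) = r • Finsupp.single f 1 := by simp
    rw [h, map_smul, map_smul, map_smul, map_smul, quotMap_covariant, Finsupp.lmapDomain_apply,
      Finsupp.mapDomain_single]

/-- For a module `F` annihilated by the kernel of `μ`, every element of `F(a)` is the image
of the class of the identity under a morphism `T_a ⟶ F`. -/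
lemma exists_hom_std {F : C ⥤ ModuleCat.{w} k} (hF : T.IsKilled F) (a : C) (x : F.obj a) :
    ∃ N : T.std a ⟶ F, (N.app a).hom (quotMap T.μ a a (Finsupp.single (𝟙 a) 1)) = x := by
  choose s hs using T.quotMap_surjective a
  have key {b : C} {p : (a ⟶ b) →₀ k} {z : (T.std a).obj b} (h : quotMap T.μ a b p = z) :
      (linAct F (s b z)).hom x = (linAct F p).hom x := by
    rw [T.linAct_eq_of_isKilled hF ((hs b z).trans h.symm)]
  refine ⟨{ app := fun b => ModuleCat.ofHom
              { toFun := fun z => (linAct F (s b z)).hom x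
                map_add' := fun z z' => ?_
                map_smul' := fun r z => ?_ }
            naturality := ?_ }, ?_⟩
  · refine (key (p := s b z + s b z') ?_).trans ?_
    · rw [map_add, hs, hs]
    · rw [map_add]; rfl
  · refine (key (p := r • s b z) ?_).trans ?_
    · rw [map_smul, hs]
    · rw [map_smul]; rfl
  · intro b c g
    ext z
    refine (key (p := Finsupp.lmapDomain k k (fun f => f ≫ g) (s b z)) ?_).trans ?_
    · rw [← quotMap_map, hs]
      rfl
    · rw [← linAct_map]; rfl
  · refine (key rfl).trans ?_
    simp

lemma modProp_coproduct {ι : Type w} (a : ι → C) : T.modProp (∐ fun i => T.std (a i)) :=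
  T.modProp.prop_colimit _ fun _ => T.modProp_std _

lemma linAct_bifunctor_eq_zero {x y : Cᵒᵖ} (p : (x ⟶ y) →₀ k)
    (hp : quotMap T.op.μ x y p = 0) : linAct T.bifunctor p = 0 :=
  hom_ext_of_quot T.μ T.quotMap_surjective (a := x.unop)
    ((linAct_app_quotMap T.μ p).trans hp)

section EssentiallySmall

variable [EssentiallySmall.{w} C]

/-- A coproduct of standard modules, indexed by the elements of `F`, mapping onto `F`. -/
lemma exists_epi {F : C ⥤ ModuleCat.{w} k} (hF : T.IsKilled F) :
    ∃ (ι : Type w) (a : ι → C) (q : (∐ fun i => T.std (a i)) ⟶ F), Epi q := by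
  let e := (equivSmallModel.{w} C).inverse
  choose N hN using fun i : (Σ a : SmallModel.{w} C, F.obj (e.obj a)) =>
    T.exists_hom_std hF (e.obj i.1) i.2
  refine ⟨Σ a : SmallModel.{w} C, F.obj (e.obj a), fun i => e.obj i.1, Sigma.desc N, ?_⟩
  rw [NatTrans.epi_iff_epi_app]
  intro b
  rw [ModuleCat.epi_iff_surjective]
  intro y
  let i := e.objObjPreimageIso b
  let j : (Σ a : SmallModel.{w} C, F.obj (e.obj a)) := ⟨e.objPreimage b, (F.map i.inv).hom y⟩
  refine ⟨((Sigma.ι (fun i : (Σ a : SmallModel.{w} C, F.obj (e.obj a)) => T.std (e.obj i.1)) j).app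
    b).hom (((T.std (e.obj j.1)).map i.hom).hom
      (quotMap T.μ _ _ (Finsupp.single (𝟙 (e.obj j.1)) 1))), ?_⟩
  have h1 := congr($(congr_app (Sigma.ι_desc N j) b).hom (((T.std (e.obj j.1)).map i.hom).hom
      (quotMap T.μ _ _ (Finsupp.single (𝟙 (e.obj j.1)) 1))))
  refine Eq.trans h1 ?_
  have h2 := congr($((N j).naturality i.hom).hom
      (quotMap T.μ _ _ (Finsupp.single (𝟙 (e.obj j.1)) 1)))
  refine Eq.trans h2 ?_
  refine (congrArg (F.map i.hom).hom (hN j)).trans ?_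
  exact congr($((F.mapIso i).inv_hom_id).hom y)

lemma modProp_of_isKilled {F : C ⥤ ModuleCat.{w} k} (hF : T.IsKilled F) : T.modProp F := by
  obtain ⟨ι, a, q, hq⟩ := T.exists_epi hF
  have hK : T.IsKilled (kernel q) :=
    ObjectProperty.prop_of_mono T.IsKilled (kernel.ι q)
      (T.isKilled_of_modProp (T.modProp_coproduct a))
  obtain ⟨ι', a', q', hq'⟩ := T.exists_epi hK
  have : T.modProp.IsClosedUnderColimitsOfShape WalkingParallelPair :=
    .of_equivalence (ULiftHomULiftCategory.equiv.{w, w} WalkingParallelPair).symm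
  have hc : IsColimit (CokernelCofork.ofπ (f := q' ≫ kernel.ι q) q (by simp)) :=
    isCokernelEpiComp (Abelian.epiIsCokernelOfKernel _ (kernelIsKernel q)) q' rfl
  refine T.modProp.prop_of_isColimit hc ?_
  rintro (_ | _)
  · exact T.modProp_coproduct a'
  · exact T.modProp_coproduct a

lemma modProp_iff (F : C ⥤ ModuleCat.{w} k) : T.modProp F ↔ T.IsKilled F :=
  ⟨T.isKilled_of_modProp, T.modProp_of_isKilled⟩

instance : T.modProp.IsClosedUnderSubobjects where
  prop_of_mono f _ h := T.modProp_of_isKilled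
    (ObjectProperty.prop_of_mono T.IsKilled f (T.isKilled_of_modProp h))

instance : T.modProp.IsClosedUnderQuotients where
  prop_of_epi f _ h := T.modProp_of_isKilled
    (ObjectProperty.prop_of_epi T.IsKilled f (T.isKilled_of_modProp h))

open ZeroObject in
instance : T.modProp.ContainsZero where
  exists_zero := ⟨0, isZero_zero _, T.modProp_of_isKilled fun a _ _ _ =>
    ((evaluation C (ModuleCat.{w} k)).obj a).map_isZero (isZero_zero _) |>.eq_of_src _ _⟩

instance : T.modProp.IsClosedUnderFiniteProducts :=
  .of_isClosedUnderLimitsOfShape.{w} fun _ _ => inferInstance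

/-- The category `C_T-mod`. -/
abbrev Mod := T.modProp.FullSubcategory

instance : Abelian T.Mod := inferInstance

/-- The `T`-standard projective `T_a` as an object of `C_T-mod`. -/
abbrev stdObj (a : C) : T.Mod := ⟨T.std a, T.modProp_std a⟩

lemma epi_hom {X Y : T.Mod} (f : X ⟶ Y) [Epi f] : Epi f.hom :=
  have := T.modProp.preservesEpimorphisms_ι_of_isNormalMonoCategory
  inferInstanceAs (Epi (T.modProp.ι.map f))

lemma exists_lift {X Y : T.Mod} (e : X ⟶ Y) [Epi e] {a : C} (f : T.std a ⟶ Y.obj) :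
    ∃ g : T.std a ⟶ X.obj, g ≫ e.hom = f := by
  have := T.epi_hom e
  have h : Epi (e.hom.app a) := inferInstance
  rw [ModuleCat.epi_iff_surjective] at h
  obtain ⟨x, hx⟩ := h ((f.app a).hom (quotMap T.μ a a (Finsupp.single (𝟙 a) 1)))
  obtain ⟨g, hg⟩ := T.exists_hom_std (T.isKilled_of_modProp X.property) a x
  exact ⟨g, hom_ext_of_quot T.μ T.quotMap_surjective ((congrArg (e.hom.app a).hom hg).trans hx)⟩

instance {ι : Type w} (a : ι → C) :
    Projective (⟨∐ fun i => T.std (a i), T.modProp_coproduct a⟩ : T.Mod) where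
  factors f e _ := by
    choose g hg using fun i => T.exists_lift e (Sigma.ι (fun i => T.std (a i)) i ≫ f.hom)
    refine ⟨ObjectProperty.homMk (Sigma.desc g), ?_⟩
    ext : 1
    refine Sigma.hom_ext _ _ fun i => ?_
    simpa using hg i

instance : EnoughProjectives T.Mod where
  presentation X := by
    obtain ⟨ι, a, q, hq⟩ := T.exists_epi (T.isKilled_of_modProp X.property)
    exact ⟨{ p := ⟨∐ fun i => T.std (a i), T.modProp_coproduct a⟩
             f := ObjectProperty.homMk q
             epi := T.modProp.ι.epi_of_epi_map hq }⟩

instance : LocallySmall.{w} (C ⥤ ModuleCat.{w} k) :=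
  locallySmall_of_faithful ((equivSmallModel.{w} C).congrLeft (E := ModuleCat.{w} k)).functor

/-- The dual `DF` of a left `C`-module: the right `C`-module `x ↦ Hom(F, T_x)`. (Since `C` is
essentially small these modules of natural transformations are `w`-small; `Shrink` replaces them
by isomorphic modules in the universe `w`.) -/
def dualObj (F : C ⥤ ModuleCat.{w} k) : Cᵒᵖ ⥤ ModuleCat.{w} k where
  obj x := ModuleCat.of k (Shrink.{w} (F ⟶ T.bifunctor.obj x))
  map f := shrinkMap (Linear.rightComp k F (T.bifunctor.map f))
  map_id x := shrinkMap_eq_id fun z => by simp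
  map_comp f g := by
    rw [shrinkMap_comp]
    congr 1
    ext z : 1
    simp

lemma dualObj_linAct (F : C ⥤ ModuleCat.{w} k) {x y : Cᵒᵖ} (p : (x ⟶ y) →₀ k) :
    linAct (T.dualObj F) p = shrinkMap (Linear.rightComp k F (linAct T.bifunctor p)) := by
  induction p using Finsupp.induction_linear with
  | zero =>
    rw [map_zero, map_zero]
    refine shrinkMap_zero.symm.trans (congrArg shrinkMap ?_)
    ext z : 1
    simp
  | add p q hp hq =>
    rw [map_add, map_add, hp, hq]
    refine (shrinkMap_add _ _).symm.trans (congrArg shrinkMap ?_)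
    ext z : 1
    simp
  | single f r =>
    rw [linAct_single, linAct_single]
    refine (shrinkMap_smul r (Linear.rightComp k F (T.bifunctor.map f))).symm.trans ?_
    congr 1

lemma modProp_dualObj (F : C ⥤ ModuleCat.{w} k) : T.op.modProp (T.dualObj F) :=
  T.op.modProp_of_isKilled fun x y p hp => by
    rw [dualObj_linAct, linAct_bifunctor_eq_zero T p hp]
    refine Eq.trans ?_ shrinkMap_zero
    congr 1

/-- The functor of duality `D : (C_T-mod)ᵒᵖ ⥤ C_{T^op}-mod`, `F ↦ DF = Hom(F, T)`. -/
def dual : T.Modᵒᵖ ⥤ T.op.Mod where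
  obj F := ⟨T.dualObj F.unop.obj, T.modProp_dualObj F.unop.obj⟩
  map {F G} φ := ObjectProperty.homMk
    { app := fun x => shrinkMap (Linear.leftComp k (T.bifunctor.obj x) φ.unop.hom)
      naturality := fun x y f => by
        refine (shrinkMap_comp _ _).trans (Eq.trans ?_ (shrinkMap_comp _ _).symm)
        congr 1 }
  map_id F := by
    ext x : 3
    exact shrinkMap_eq_id fun z => by simp
  map_comp f g := by
    ext x : 3
    refine Eq.trans ?_ (shrinkMap_comp _ _).symm
    congr 1

instance : T.dual.Additive where
  map_add {F G f g} := by
    ext x : 3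
    refine Eq.trans ?_ (shrinkMap_add _ _)
    refine congrArg shrinkMap ?_
    ext z : 1
    exact Preadditive.add_comp (C := C ⥤ ModuleCat.{w} k) _ _ _ f.unop.hom g.unop.hom z

instance : HasFiniteBiproducts T.Mod := Abelian.hasFiniteBiproducts

/-- Chosen models of the derived categories. -/
instance : HasDerivedCategory T.Mod := HasDerivedCategory.standard _

instance : HasDerivedCategory T.Modᵒᵖ := HasDerivedCategory.standard _

/-- The derived functor `RD` of the functor of duality, where `D⁻(C_T-mod)ᵒᵖ` is identified with
`D⁺((C_T-mod)ᵒᵖ)`. -/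
def RD : DerivedCategory.Plus T.Modᵒᵖ ⥤ DerivedCategory.Plus T.op.Mod :=
  T.dual.rightDerivedFunctorPlus

/-- `RD(F)` for a module `F`, considered as a complex concentrated in degree `0`. -/
def RDObj (F : T.Mod) : DerivedCategory.Plus T.op.Mod :=
  T.RD.obj ((DerivedCategory.Plus.singleFunctor T.Modᵒᵖ 0).obj (Opposite.op F))

/-- `D^n(F) = H^n(RD(F))`. -/
def dualCohomology (n : ℤ) (F : T.Mod) : T.op.Mod :=
  (DerivedCategory.Plus.homologyFunctor T.op.Mod n).obj (T.RDObj F)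

/-- `F` is an Eilenberg-Mac Lane functor of degree `n` if `RD(F) ≅ D^n(F)[n]`, where `X[n]` denotes
the complex with `X` placed in degree `n`. -/
def IsEilenbergMacLane (n : ℤ) (F : T.Mod) : Prop :=
  Nonempty (T.RDObj F ≅
    (DerivedCategory.Plus.singleFunctor T.op.Mod n).obj (T.dualCohomology n F))

/-- `F` is of finite type if it is a quotient of a finite sum of `T`-standard projectives. -/
def IsFiniteType (F : T.Mod) : Prop :=
  ∃ (m : ℕ) (a : Fin m → C) (q : (⨁ fun i => T.stdObj (a i)) ⟶ F), Epi q

/-- `F` is of type `FP` if it has a finite resolution by projectives of finite type. -/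
def IsTypeFP (F : T.Mod) : Prop :=
  ∃ P : ProjectiveResolution F, (∀ i, T.IsFiniteType (P.complex.X i)) ∧
    ∃ m : ℕ, ∀ i, m < i → IsZero (P.complex.X i)

/-- `F` is a duality functor if it is of type `FP` and an Eilenberg-Mac Lane functor of some
degree. -/
def IsDualityFunctor (F : T.Mod) : Prop :=
  T.IsTypeFP F ∧ ∃ n : ℤ, T.IsEilenbergMacLane n F

end EssentiallySmall

end YonedaBifunctor
end

/-! On finitely generated projectives `D` is a perfect duality. The Yoneda bijection gives `D(T_a) ≅
T^op_a`, evaluation `F ⟶ DDF` is invertible on each `T_a`, and additivity extends this to direct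
summands of finite sums (`HasFiniteDualBasis.isIso_toBidual`).

A module `F` of type `FP` and projective dimension `n` has a resolution `Z` by such projectives in
degrees `-n, ..., 0`, obtained by truncating any resolution at its `n`-th syzygy
(`exists_isFiniteResolution`), and `D^i(F)` is the cohomology of `DZ`. If `D^n(F)` vanished, then
`D(Z^(1-n)) ⟶ D(Z^(-n))` would be a split epimorphism; dualizing the section would split the first
map of `Z`, so that `F` would have projective dimension less than `n` (`exists_retraction`,
`hasProjectiveDimensionLT`). Hence the single degree carrying the cohomology of `RD(F)` is `n`.

Consequently `DZ`, shifted by `n`, is a finite resolution of `D^n(F)`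
(`IsFiniteResolution.reverse`). Dualizing it returns `Z` by biduality, so `D^i(D^n(F))` is `F` for
`i = n` and zero otherwise. The projective dimension of `D^n(F)` is at most `n`, and it cannot be
smaller because `D^n(D^n(F)) ≅ F` is nonzero. -/

noncomputable section

/-! ### Contravariant functors applied to cochain complexes -/

section Reverse

variable {A B : Type*} [Category* A] [Category* B]

section

variable [HasZeroMorphisms A] [HasZeroMorphisms B] (G : Aᵒᵖ ⥤ B) [G.PreservesZeroMorphisms]

/-- The cochain complex `i ↦ G (Z^(n - i))` for a contravariant functor `G`. -/
@[simps]
def CochainComplex.reverse (n : ℤ) (Z : CochainComplex A ℤ) : CochainComplex B ℤ where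
  X i := G.obj (op (Z.X (n - i)))
  d i j := G.map (Z.d (n - j) (n - i)).op
  shape i j h := by
    rw [Z.shape, op_zero, G.map_zero]
    simp only [ComplexShape.up_Rel] at h ⊢
    lia
  d_comp_d' i j k _ _ := by rw [← G.map_comp, ← op_comp, Z.d_comp_d, op_zero, G.map_zero]

/-- The short complex `G (Z^c) ⟶ G (Z^b) ⟶ G (Z^a)` for a contravariant functor `G`. -/
@[simps]
def CochainComplex.opSc (Z : CochainComplex A ℤ) (a b c : ℤ) : ShortComplex B where
  X₁ := G.obj (op (Z.X c))
  X₂ := G.obj (op (Z.X b))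
  X₃ := G.obj (op (Z.X a))
  f := G.map (Z.d b c).op
  g := G.map (Z.d a b).op
  zero := by rw [← G.map_comp, ← op_comp, Z.d_comp_d, op_zero, G.map_zero]

/-- The right-hand side does not mention `n`: keeping `a`, `b`, `c` as free variables allows
reversals with different shifts to be compared through the same short complex. -/
lemma CochainComplex.nonempty_reverse_homology_iso [CategoryWithHomology B] (n : ℤ)
    (Z : CochainComplex A ℤ) (i a b c : ℤ) (ha : n - (i + 1) = a := by lia)
    (hb : n - i = b := by lia) (hc : n - (i - 1) = c := by lia) :
    Nonempty ((CochainComplex.reverse G n Z).homology i ≅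
      (CochainComplex.opSc G Z a b c).homology) := by
  subst ha hb hc
  exact ⟨HomologicalComplex.homologyIsoSc' _ (i - 1) i (i + 1) (by simp) (by simp)⟩

end

end Reverse

/-! ### Right derived functors computed by resolutions -/

section Derived

variable {A B : Type*} [Category* A] [Category* B] [Abelian A] [Abelian B]

/-- Cohomology in the single degree `n` puts the object in both halves of the canonical t-structure
at `n`, hence in the shifted heart. -/
lemma DerivedCategory.Plus.nonempty_iso_single [HasDerivedCategory A] (X : DerivedCategory.Plus A)
    (n : ℤ) (h : ∀ i, i ≠ n → IsZero ((DerivedCategory.Plus.homologyFunctor A i).obj X)) :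
    Nonempty (X ≅ (DerivedCategory.Plus.singleFunctor A n).obj
      ((DerivedCategory.Plus.homologyFunctor A n).obj X)) := by
  let X' : DerivedCategory A := DerivedCategory.Plus.ι.obj X
  have h1 : X'.IsGE n := (DerivedCategory.isGE_iff X' n).2 fun i hi => h i hi.ne
  have h2 : X'.IsLE n := (DerivedCategory.isLE_iff X' n).2 fun i hi => h i hi.ne'
  obtain ⟨Y, ⟨e⟩⟩ := DerivedCategory.exists_iso_singleFunctor_obj_of_isGE_of_isLE X' n
  have e' : X ≅ (DerivedCategory.Plus.singleFunctor A n).obj Y :=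
    DerivedCategory.Plus.ι.preimageIso e
  have e2 : (DerivedCategory.Plus.homologyFunctor A n).obj X ≅ Y :=
    (DerivedCategory.homologyFunctor A n).mapIso e ≪≫
      (DerivedCategory.singleFunctorCompHomologyFunctorIso A n).app Y
  exact ⟨e' ≪≫ (DerivedCategory.Plus.singleFunctor A n).mapIso e2.symm⟩

lemma DerivedCategory.Plus.isZero_homology_single [HasDerivedCategory A] (X : A) {n i : ℤ}
    (h : i ≠ n) : IsZero ((DerivedCategory.Plus.homologyFunctor A i).obj
      ((DerivedCategory.Plus.singleFunctor A n).obj X)) := by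
  obtain h | h := h.lt_or_gt
  · exact DerivedCategory.Plus.isZero_homology_of_isGE _ n i h
  · exact DerivedCategory.Plus.isZero_homology_of_isLE _ n i h

lemma DerivedCategory.Plus.nonempty_homology_Q_iso [HasDerivedCategory A]
    (K : CochainComplex.Plus A) (i : ℤ) :
    Nonempty ((DerivedCategory.Plus.homologyFunctor A i).obj (DerivedCategory.Plus.Q.obj K) ≅
      K.obj.homology i) :=
  ⟨(DerivedCategory.homologyFunctor A i).mapIso
      ((DerivedCategory.quotientCompQhIso A).app K.obj) ≪≫
    (DerivedCategory.homologyFunctorFactors A i).app K.obj⟩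

/-- The unit of the right derived functor is invertible on bounded below complexes of injectives,
and `K` is isomorphic in the derived category to its only cohomology object. -/
lemma CategoryTheory.Functor.nonempty_homology_rightDerivedFunctorPlus_iso
    [HasDerivedCategory A] [HasDerivedCategory B] [EnoughInjectives A] (G : A ⥤ B) [G.Additive]
    (K : CochainComplex A ℤ) [K.IsStrictlyGE 0] (hK : ∀ i, Injective (K.X i))
    (hK' : ∀ i, i ≠ 0 → K.ExactAt i) (i : ℤ) :
    Nonempty ((DerivedCategory.Plus.homologyFunctor B i).obj (G.rightDerivedFunctorPlus.obj
      ((DerivedCategory.Plus.singleFunctor A 0).obj (K.homology 0))) ≅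
        ((G.mapHomologicalComplex (.up ℤ)).obj K).homology i) := by
  let L₀ : CochainComplex (InjectiveObject A) ℤ := HomologicalComplex.liftObjectProperty _ K hK
  let L : CochainComplex.Plus (InjectiveObject A) := ⟨L₀, 0, by
    rw [← CochainComplex.isStrictlyGE_mapHomologicalComplex_obj_iff _ (InjectiveObject.ι _)]
    assumption⟩
  let K' : CochainComplex.Plus A := (InjectiveObject.ι A).mapCochainComplexPlus.obj L
  have hK'K : K'.obj = K := rfl
  let e0 := fun i => (DerivedCategory.Plus.nonempty_homology_Q_iso K' i).some
  obtain ⟨e1⟩ := DerivedCategory.Plus.nonempty_iso_single (DerivedCategory.Plus.Q.obj K') 0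
    fun i hi => (hK' i hi).isZero_homology.of_iso (e0 i)
  let e2 : DerivedCategory.Plus.Q.obj K' ≅
      (DerivedCategory.Plus.singleFunctor A 0).obj (K.homology 0) :=
    e1 ≪≫ (DerivedCategory.Plus.singleFunctor A 0).mapIso (e0 0)
  have : IsIso (G.rightDerivedFunctorPlusUnit.app
      ((HomotopyCategory.Plus.quotient A).obj K')) := by
    dsimp only [K']
    infer_instance
  let e3 := asIso (G.rightDerivedFunctorPlusUnit.app ((HomotopyCategory.Plus.quotient A).obj K'))
  let e4 : DerivedCategory.Plus.Q.obj (G.mapCochainComplexPlus.obj K') ≅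
    G.rightDerivedFunctorPlus.obj (DerivedCategory.Plus.Q.obj K') := e3
  exact ⟨(DerivedCategory.Plus.homologyFunctor B i).mapIso
      (G.rightDerivedFunctorPlus.mapIso e2.symm ≪≫ e4.symm) ≪≫
    (DerivedCategory.Plus.nonempty_homology_Q_iso (G.mapCochainComplexPlus.obj K') i).some⟩

/-- A complex of projective objects in degrees `≤ 0` whose only homology object is `X`,
placed in degree `0`. -/
structure CochainComplex.IsProjectiveResolution (Z : CochainComplex A ℤ) (X : A) : Prop where
  projective (i : ℤ) : Projective (Z.X i)
  isZero (i : ℤ) (hi : 0 < i) : IsZero (Z.X i)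
  exactAt (i : ℤ) (hi : i ≠ 0) : Z.ExactAt i
  nonempty_iso : Nonempty (Z.homology 0 ≅ X)

variable {Z : CochainComplex A ℤ} {X : A}

lemma CochainComplex.IsProjectiveResolution.nonempty_homology_rightDerivedFunctorPlus_iso
    [HasDerivedCategory Aᵒᵖ] [HasDerivedCategory B] [EnoughProjectives A] (G : Aᵒᵖ ⥤ B)
    [G.Additive] (hZ : Z.IsProjectiveResolution X) (i : ℤ) :
    Nonempty ((DerivedCategory.Plus.homologyFunctor B i).obj (G.rightDerivedFunctorPlus.obj
      ((DerivedCategory.Plus.singleFunctor Aᵒᵖ 0).obj (op X))) ≅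
        (CochainComplex.reverse G 0 Z).homology i) := by
  -- Reversing with the identity functor of `Aᵒᵖ` gives an injective resolution of `op X`; applying
  -- `G` to it termwise is `reverse G 0 Z` by definition.
  let K := CochainComplex.reverse (𝟭 Aᵒᵖ) 0 Z
  have : K.IsStrictlyGE 0 := (CochainComplex.isStrictlyGE_iff _ _).2 fun i hi =>
    (hZ.isZero (0 - i) (by lia)).op
  have hp (i : ℤ) : Injective (K.X i) :=
    have := hZ.projective (0 - i)
    inferInstanceAs (Injective (op (Z.X (0 - i))))
  have hH (i : ℤ) : Nonempty (K.homology i ≅ op (Z.homology (- i))) := by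
    obtain ⟨e⟩ := CochainComplex.nonempty_reverse_homology_iso (𝟭 Aᵒᵖ) 0 Z i
      (-i - 1) (-i) (-i + 1)
    let e' : (Z.sc' (-i - 1) (-i) (-i + 1)).homology ≅ Z.homology (-i) :=
      (HomologicalComplex.homologyIsoSc' _ _ _ _ (by simp) (by simp)).symm
    exact ⟨e ≪≫ (Z.sc' (-i - 1) (-i) (-i + 1)).homologyOpIso ≪≫ e'.symm.op⟩
  have hex (i : ℤ) (hi : i ≠ 0) : K.ExactAt i := by
    rw [HomologicalComplex.exactAt_iff_isZero_homology]
    exact (hZ.exactAt (-i) (by lia)).isZero_homology.op.of_iso (hH i).some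
  obtain ⟨e⟩ := G.nonempty_homology_rightDerivedFunctorPlus_iso K hp hex i
  obtain ⟨e1⟩ := hH 0
  obtain ⟨e2⟩ := hZ.nonempty_iso
  exact ⟨(DerivedCategory.Plus.homologyFunctor B i).mapIso (G.rightDerivedFunctorPlus.mapIso
    ((DerivedCategory.Plus.singleFunctor Aᵒᵖ 0).mapIso (e2.op ≪≫ e1.symm))) ≪≫ e⟩

end Derived

/-! ### Syzygies, truncation and projective dimension -/

section Resolutions

variable {A : Type*} [Category* A] [Abelian A]

lemma CategoryTheory.ShortComplex.ShortExact.projective_X₃ {S : ShortComplex A}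
    (hS : S.ShortExact) [Projective S.X₂] (r : S.X₂ ⟶ S.X₁) (hr : S.f ≫ r = 𝟙 S.X₁) :
    Projective S.X₃ := by
  have := hS.epi_g
  let s := ShortComplex.Splitting.ofExactOfRetraction S hS.exact r hr hS.epi_g
  exact Retract.projective (Y := S.X₂) ⟨s.s, S.g, s.s_g⟩

namespace CochainComplex

/-- The syzygy sequence: in a resolution, the opcycles in degree `-i` are the `i`-th syzygy. The
kernel of `fromOpcycles` is the homology in degree `i`, which vanishes. -/
lemma shortExact_opcycles (Z : CochainComplex A ℤ) {i j : ℤ} (hij : i + 1 = j)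
    (h : Z.ExactAt i) :
    (ShortComplex.mk (Z.fromOpcycles i j) (Z.pOpcycles j) (by
      rw [← cancel_epi (Z.pOpcycles i), Z.p_fromOpcycles_assoc, Z.d_pOpcycles,
        comp_zero])).ShortExact where
  exact := by
    have h1 : (ShortComplex.mk (Z.d i j) (Z.pOpcycles j) (Z.d_pOpcycles i j)).Exact :=
      ShortComplex.exact_of_g_is_cokernel _ (Z.opcyclesIsCokernel i j (by simp; lia))
    -- Replacing `Z^i` by its quotient of opcycles does not change the image in `Z^j`, so exactness
    -- transfers along `α`.
    let α : ShortComplex.mk (Z.d i j) (Z.pOpcycles j) (Z.d_pOpcycles i j) ⟶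
      ShortComplex.mk (Z.fromOpcycles i j) (Z.pOpcycles j) (by
        rw [← cancel_epi (Z.pOpcycles i), Z.p_fromOpcycles_assoc, Z.d_pOpcycles, comp_zero]) :=
      { τ₁ := Z.pOpcycles i
        τ₂ := 𝟙 _
        τ₃ := 𝟙 _ }
    have : Epi α.τ₁ := inferInstanceAs (Epi (Z.pOpcycles i))
    have : IsIso α.τ₂ := inferInstanceAs (IsIso (𝟙 _))
    have : Mono α.τ₃ := inferInstanceAs (Mono (𝟙 _))
    exact (ShortComplex.exact_iff_of_epi_of_isIso_of_mono α).1 h1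
  mono_f := Preadditive.mono_of_isZero_kernel'
    _ (Z.homologyIsKernel i j (by simp; lia)) h.isZero_homology
  epi_g := inferInstanceAs (Epi (Z.pOpcycles j))

namespace IsProjectiveResolution

variable {Z : CochainComplex A ℤ} {X : A}

lemma nonempty_opcycles_iso (hZ : Z.IsProjectiveResolution X) : Nonempty (Z.opcycles 0 ≅ X) := by
  have : IsIso (Z.homologyι 0) := Z.isIso_homologyι 0 1 (by simp)
    ((hZ.isZero 1 (by lia)).eq_of_tgt _ _)
  exact ⟨(asIso (Z.homologyι 0)).symm ≪≫ hZ.nonempty_iso.some⟩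

/-- Dimension shifting along the syzygy sequences, whose middle terms are projective. `k` is
generalized since each step of the induction trades one syzygy for one dimension. -/
lemma hasProjectiveDimensionLT_opcycles (hZ : Z.IsProjectiveResolution X) (k i : ℕ)
    (h : HasProjectiveDimensionLT X (k + i + 1)) :
    HasProjectiveDimensionLT (Z.opcycles (-i)) (k + 1) := by
  induction i generalizing k with
  | zero => exact hasProjectiveDimensionLT_of_iso hZ.nonempty_opcycles_iso.some.symm _
  | succ i hi =>
    have := hZ.projective (-i)
    refine (Z.shortExact_opcycles (i := -((i + 1 : ℕ) : ℤ)) (j := -i) (by lia)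
      (hZ.exactAt _ (by lia))).hasProjectiveDimensionLT_X₁ (k + 1) ?_
        (hi (k + 1) (by convert h using 1; lia))
    change HasProjectiveDimensionLT (Z.X (-i)) (k + 1)
    exact hasProjectiveDimensionLT_of_ge _ 1 _ (by lia)

lemma hasProjectiveDimensionLT_of_opcycles (hZ : Z.IsProjectiveResolution X) (k i : ℕ)
    (h : HasProjectiveDimensionLT (Z.opcycles (-i)) (k + 1)) :
    HasProjectiveDimensionLT X (k + i + 1) := by
  induction i generalizing k with
  | zero =>
    exact @hasProjectiveDimensionLT_of_iso _ _ _ _ _ hZ.nonempty_opcycles_iso.some _ h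
  | succ i hi =>
    have := hZ.projective (-i)
    convert hi (k + 1) ((Z.shortExact_opcycles (i := -((i + 1 : ℕ) : ℤ)) (j := -i) (by lia)
      (hZ.exactAt _ (by lia))).hasProjectiveDimensionLT_X₃ (k + 1) h ?_) using 1
    · lia
    · change HasProjectiveDimensionLT (Z.X (-i)) (k + 1 + 1)
      exact hasProjectiveDimensionLT_of_ge _ 1 _ (by lia)

lemma isStrictlyLE (hZ : Z.IsProjectiveResolution X) : Z.IsStrictlyLE 0 :=
  (isStrictlyLE_iff _ _).2 hZ.isZero

lemma projective_opcycles (hZ : Z.IsProjectiveResolution X) (n : ℕ)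
    [h : HasProjectiveDimensionLT X (n + 1)] : Projective (Z.opcycles (-n)) := by
  rw [projective_iff_hasProjectiveDimensionLT_one]
  exact hZ.hasProjectiveDimensionLT_opcycles 0 n (by simpa using h)

/-- The canonical truncation of a projective resolution at the projective dimension. -/
lemma truncGE (hZ : Z.IsProjectiveResolution X) (n : ℕ) [HasProjectiveDimensionLT X (n + 1)] :
    (Z.truncGE (-n)).IsProjectiveResolution X := by
  have := hZ.isStrictlyLE
  have : Z.IsGE (-n) := (isGE_iff _ _).2 fun i hi => hZ.exactAt i (by lia)
  have : (Z.truncGE (-n)).IsStrictlyLE 0 := inferInstance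
  have e (i : ℤ) : Z.homology i ≅ (Z.truncGE (-n)).homology i :=
    isoOfQuasiIsoAt (Z.πTruncGE (-n)) i
  refine ⟨fun i => ?_, fun i hi => isZero_of_isStrictlyLE _ 0 i hi, fun i hi => ?_,
    ⟨(e 0).symm ≪≫ hZ.nonempty_iso.some⟩⟩
  · obtain hi | rfl | hi := lt_trichotomy i (-n)
    · exact (isZero_of_isStrictlyGE _ (-n) i hi).projective
    -- The lowest term of the truncation is the `n`-th syzygy, projective by the dimension bound.
    · have := hZ.projective_opcycles n
      exact Projective.of_iso (Z.truncGEXIsoOpcycles (-n)).symm inferInstance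
    · exact Projective.of_iso (Z.truncGEXIso (-n) i hi).symm (hZ.projective i)
  · rw [HomologicalComplex.exactAt_iff_isZero_homology]
    exact (hZ.exactAt i hi).isZero_homology.of_iso (e i).symm

end IsProjectiveResolution

end CochainComplex

lemma CategoryTheory.ProjectiveResolution.isProjectiveResolution {X : A}
    (P : ProjectiveResolution X) : P.cochainComplex.IsProjectiveResolution X := by
  have e (i : ℤ) : P.cochainComplex.homology i ≅
      ((CochainComplex.singleFunctor A 0).obj X).homology i := isoOfQuasiIsoAt P.π' i
  refine ⟨inferInstance, fun i hi => CochainComplex.isZero_of_isStrictlyLE _ 0 i hi,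
    fun i hi => ?_, ⟨e 0 ≪≫ HomologicalComplex.singleObjHomologySelfIso _ _ _⟩⟩
  rw [HomologicalComplex.exactAt_iff_isZero_homology]
  exact (HomologicalComplex.isZero_single_obj_homology _ _ _ _ hi).of_iso (e i)

namespace CochainComplex

/-- The chain complex indexed by `ℕ` given by the terms of nonpositive degree. -/
@[simps]
def nonpositivePart (Z : CochainComplex A ℤ) : ChainComplex A ℕ where
  X i := Z.X (-i)
  d i j := Z.d (-i) (-j)
  shape i j h := Z.shape _ _ (by simp only [ComplexShape.up_Rel, ComplexShape.down_Rel] at h ⊢; lia)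

namespace IsProjectiveResolution

variable {Z : CochainComplex A ℤ} {X : A}

/-- Returns to the form of resolution used in `IsTypeFP`; the augmentation is `Z^0 ⟶ opcycles 0 ≅
X`. -/
lemma exists_projectiveResolution (hZ : Z.IsProjectiveResolution X) :
    ∃ P : ProjectiveResolution X, P.complex = Z.nonpositivePart := by
  obtain ⟨e⟩ := hZ.nonempty_opcycles_iso
  let f : Z.nonpositivePart.X 0 ⟶ X := (Z.pOpcycles 0 ≫ e.hom : Z.X 0 ⟶ X)
  have hf : Z.nonpositivePart.d 1 0 ≫ f = 0 := by
    have : Z.d (-1) 0 ≫ Z.pOpcycles 0 ≫ e.hom = 0 := by simp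
    exact this
  refine ⟨{ complex := Z.nonpositivePart
            projective := fun n => hZ.projective (-n)
            π := (ChainComplex.toSingle₀Equiv _ _).symm ⟨f, hf⟩
            quasiIso := ⟨fun n => ?_⟩ }, rfl⟩
  cases n with
  | zero =>
    rw [ChainComplex.quasiIsoAt₀_iff, ShortComplex.quasiIso_iff_of_zeros']
    · have h1 : (ShortComplex.mk (Z.d (-1) 0) (Z.pOpcycles 0) (Z.d_pOpcycles _ _)).Exact :=
        ShortComplex.exact_of_g_is_cokernel _ (Z.opcyclesIsCokernel (-1) 0 (by simp))
      have h2 : Z.pOpcycles 0 = ((Z.nonpositivePart.toSingle₀Equiv X).symm ⟨f, hf⟩).f 0 ≫ e.inv := by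
        rw [ChainComplex.toSingle₀Equiv_symm_apply_f_zero]
        exact ((Iso.comp_inv_eq e).2 rfl).symm
      refine (ShortComplex.exact_and_epi_g_iff_of_iso ?_).2
        ⟨h1, inferInstanceAs (Epi (Z.pOpcycles 0))⟩
      exact ShortComplex.isoMk (Iso.refl _) (Iso.refl _) e.symm
        ((Category.id_comp (Z.d (-1) 0)).trans (Category.comp_id (Z.d (-1) 0)).symm)
        ((Category.id_comp (Z.pOpcycles 0)).trans h2)
    all_goals first | rfl | exact HomologicalComplex.shape _ _ _ (by simp)
  | succ n =>
    rw [quasiIsoAt_iff_exactAt']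
    · rw [HomologicalComplex.exactAt_iff' _ (n + 1 + 1) (n + 1) n (by simp) (by simp)]
      exact (HomologicalComplex.exactAt_iff' Z (-((n + 1 + 1 : ℕ) : ℤ)) (-((n + 1 : ℕ) : ℤ)) (-n)
        (by simp; lia) (by simp)).1 (hZ.exactAt _ (by lia))
    · apply ChainComplex.exactAt_succ_single_obj

end IsProjectiveResolution

end CochainComplex

end Resolutions

/-! ### Finitely generated projectives and biduality -/

namespace YonedaBifunctor

variable {C : Type u} [Category.{w} C] {k : Type w} [CommRing k] (T : YonedaBifunctor C k)

/-- The class of the identity of `a` in `T(a, a)`. -/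
abbrev unit (a : C) : (T.std a).obj a := quotMap T.μ a a (Finsupp.single (𝟙 a) 1)

variable [EssentiallySmall.{w} C]

instance : T.modProp.ι.PreservesHomology where
  preservesKernels := @fun _ _ f => T.modProp.preservesKernels_ι f
  preservesCokernels := @fun _ _ f => T.modProp.preservesCokernels_ι f

instance (a : C) : Projective (T.stdObj a) where
  factors f e _ := by
    obtain ⟨g, hg⟩ := T.exists_lift e f.hom
    exact ⟨ObjectProperty.homMk g, by ext : 1; exact hg⟩

/-- `X` is a direct summand of a finite sum of `T`-standard projectives, expressed through a
finite dual basis. -/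
def HasFiniteDualBasis (X : T.Mod) : Prop :=
  ∃ (m : ℕ) (a : Fin m → C) (i : ∀ j, X ⟶ T.stdObj (a j)) (p : ∀ j, T.stdObj (a j) ⟶ X),
    ∑ j, i j ≫ p j = 𝟙 X

variable {T}

lemma HasFiniteDualBasis.projective {X : T.Mod} (h : T.HasFiniteDualBasis X) : Projective X where
  factors f e _ := by
    obtain ⟨m, a, i, p, hip⟩ := h
    refine ⟨∑ j, i j ≫ Projective.factorThru (p j ≫ f) e, ?_⟩
    rw [Preadditive.sum_comp]
    simp only [Category.assoc, Projective.factorThru_comp]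
    simp only [← Category.assoc]
    rw [← Preadditive.sum_comp, hip, Category.id_comp]

lemma HasFiniteDualBasis.isFiniteType {X : T.Mod} (h : T.HasFiniteDualBasis X) :
    T.IsFiniteType X := by
  obtain ⟨m, a, i, p, hip⟩ := h
  have : IsSplitEpi (biproduct.desc p) := ⟨⟨biproduct.lift i, by simp [biproduct.lift_desc, hip]⟩⟩
  exact ⟨m, a, biproduct.desc p, inferInstance⟩

lemma IsFiniteType.hasFiniteDualBasis {X : T.Mod} (h : T.IsFiniteType X) [Projective X] :
    T.HasFiniteDualBasis X := by
  obtain ⟨m, a, q, _⟩ := h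
  refine ⟨m, a, fun j => Projective.factorThru (𝟙 X) q ≫ biproduct.π (fun i => T.stdObj (a i)) j,
    fun j => biproduct.ι (fun i => T.stdObj (a i)) j ≫ q, ?_⟩
  have : ∑ j, (Projective.factorThru (𝟙 X) q ≫ biproduct.π (fun i => T.stdObj (a i)) j) ≫
      biproduct.ι (fun i => T.stdObj (a i)) j ≫ q =
      Projective.factorThru (𝟙 X) q ≫ (∑ j, biproduct.π (fun i => T.stdObj (a i)) j ≫
        biproduct.ι (fun i => T.stdObj (a i)) j) ≫ q := by
    rw [Preadditive.sum_comp, Preadditive.comp_sum]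
    simp only [Category.assoc]
  rw [this, biproduct.total, Category.id_comp, Projective.factorThru_comp]

lemma IsFiniteType.of_epi {X Y : T.Mod} (h : T.IsFiniteType X) (f : X ⟶ Y) [Epi f] :
    T.IsFiniteType Y := by
  obtain ⟨m, a, q, _⟩ := h
  exact ⟨m, a, q ≫ f, epi_comp q f⟩

lemma isFiniteType_of_isZero {X : T.Mod} (h : IsZero X) : T.IsFiniteType X :=
  ⟨0, Fin.elim0, 0, ⟨fun _ _ _ => h.eq_of_src _ _⟩⟩

variable (T)

/-- Evaluation at `ξ ∈ F(x)` of the morphisms `F ⟶ G`. -/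
@[simps]
def evalAt (F G : C ⥤ ModuleCat.{w} k) {x : C} (ξ : F.obj x) : (F ⟶ G) →ₗ[k] G.obj x where
  toFun N := (N.app x).hom ξ
  map_add' _ _ := rfl
  map_smul' _ _ := rfl

/-- The elements of `(DF)(x)` are the morphisms `F ⟶ T_x`. -/
def dualEquiv (F : C ⥤ ModuleCat.{w} k) (x : Cᵒᵖ) :
    (T.dualObj F).obj x ≃ₗ[k] (F ⟶ T.bifunctor.obj x) :=
  Shrink.linearEquiv k (F ⟶ T.bifunctor.obj x)

lemma dualEquiv_map (F : C ⥤ ModuleCat.{w} k) {x y : Cᵒᵖ} (f : x ⟶ y) (N : (T.dualObj F).obj x) :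
    T.dualEquiv F y (((T.dualObj F).map f).hom N) = T.dualEquiv F x N ≫ T.bifunctor.map f :=
  (Shrink.linearEquiv k (F ⟶ T.bifunctor.obj y)).apply_symm_apply _

lemma dualEquiv_dual_map {F G : T.Mod} (φ : F ⟶ G) (x : Cᵒᵖ) (N : (T.dualObj G.obj).obj x) :
    T.dualEquiv F.obj x (((T.dual.map φ.op).hom.app x).hom N) =
      φ.hom ≫ T.dualEquiv G.obj x N :=
  (Shrink.linearEquiv k (F.obj ⟶ T.bifunctor.obj x)).apply_symm_apply _

/-- The dual of the standard module `T_a` is the standard module `T^op_a`. -/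
def dualStdIso (a : C) : T.dualObj (T.std a) ≅ T.op.std (Opposite.op a) :=
  NatIso.ofComponents
    (fun y => ((T.dualEquiv (T.std a) y).trans
      (LinearEquiv.ofBijective (evalAt (T.std a) (T.bifunctor.obj y) (T.unit a))
        (T.bijective y.unop a))).toModuleIso)
    (fun {y z} f => by
      ext N
      exact congrArg (evalAt (T.std a) (T.bifunctor.obj z) (T.unit a))
        (T.dualEquiv_map (T.std a) f N))

/-- The generator of `D(T_a) ≅ T^op_a` is the identity of `T_a`, so evaluating there undoes
biduality. -/
lemma dualStdIso_inv_unit (a : C) :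
    T.dualEquiv (T.std a) (Opposite.op a)
      (((T.dualStdIso a).inv.app (Opposite.op a)).hom (T.op.unit (Opposite.op a))) = 𝟙 _ := by
  let e := LinearEquiv.ofBijective (evalAt (T.std a) (T.std a) (T.unit a)) (T.bijective a a)
  refine ((T.dualEquiv (T.std a) (Opposite.op a)).apply_symm_apply _).trans
    (e.injective ((e.apply_symm_apply _).trans ?_))
  refine congrArg (quotMap T.μ a a) ?_
  exact (Finsupp.mapDomain_single)

/-- Evaluation at the elements of `F(x)`, as morphisms `DF ⟶ T(x, -)`. -/
def evalHom (F : C ⥤ ModuleCat.{w} k) (x : C) :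
    F.obj x →ₗ[k] (T.dualObj F ⟶ T.op.bifunctor.obj ((opOp C).obj x)) where
  toFun ξ :=
    { app := fun y =>
        ModuleCat.ofHom (evalAt F (T.bifunctor.obj y) ξ ∘ₗ (T.dualEquiv F y).toLinearMap)
      naturality := fun y z f => by
        ext N
        exact congrArg (evalAt F (T.bifunctor.obj z) ξ) (T.dualEquiv_map F f N) }
  map_add' ξ ξ' := by
    ext y N
    exact map_add ((T.dualEquiv F y N).app x).hom ξ ξ'
  map_smul' r ξ := by
    ext y N
    exact map_smul ((T.dualEquiv F y N).app x).hom r ξ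

/-- The biduality morphism `F ⟶ DDF`. -/
def biduality (F : C ⥤ ModuleCat.{w} k) : F ⟶ opOp C ⋙ T.op.dualObj (T.dualObj F) where
  app x := ModuleCat.ofHom
    ((T.op.dualEquiv (T.dualObj F) ((opOp C).obj x)).symm.toLinearMap ∘ₗ T.evalHom F x)
  naturality x y f := by
    ext ξ
    apply (T.op.dualEquiv (T.dualObj F) _).injective
    refine ((T.op.dualEquiv (T.dualObj F) _).apply_symm_apply _).trans
      (Eq.trans ?_ (T.op.dualEquiv_map (T.dualObj F) ((opOp C).map f) _).symm)
    refine Eq.trans ?_ (congrArg (· ≫ T.op.bifunctor.map ((opOp C).map f))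
      ((T.op.dualEquiv (T.dualObj F) _).apply_symm_apply (T.evalHom F x ξ)).symm)
    ext z N
    exact congr($((T.dualEquiv F z N).naturality f).hom ξ)

lemma dualEquiv_biduality (F : C ⥤ ModuleCat.{w} k) {x : C} (ξ : F.obj x) :
    T.op.dualEquiv (T.dualObj F) _ (((T.biduality F).app x).hom ξ) = T.evalHom F x ξ :=
  (T.op.dualEquiv (T.dualObj F) _).apply_symm_apply _

/-- Evaluation `E` at the generator of `D(T_a)` is a left inverse of biduality. It is injective
because a morphism out of `T^op_a` is determined by its value at the unit, so biduality is
bijective. -/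
instance (a : C) : IsIso (T.biduality (T.std a)) := by
  rw [NatTrans.isIso_iff_isIso_app]
  intro x
  let E : (T.op.dualObj (T.dualObj (T.std a))).obj ((opOp C).obj x) →ₗ[k] (T.std a).obj x :=
    evalAt (T.dualObj (T.std a)) (T.op.bifunctor.obj ((opOp C).obj x))
      (((T.dualStdIso a).inv.app (Opposite.op a)).hom (T.op.unit (Opposite.op a))) ∘ₗ
        (T.op.dualEquiv (T.dualObj (T.std a)) _).toLinearMap
  have h1 (ξ : (T.std a).obj x) : E (((T.biduality (T.std a)).app x).hom ξ) = ξ := by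
    refine (congrArg (evalAt (T.dualObj (T.std a)) (T.op.bifunctor.obj ((opOp C).obj x)) _)
      (T.dualEquiv_biduality (T.std a) ξ)).trans ?_
    exact congr((($(T.dualStdIso_inv_unit a)).app x).hom ξ)
  have h2 : Function.Injective E := by
    intro φ ψ h
    apply (T.op.dualEquiv (T.dualObj (T.std a)) _).injective
    rw [← cancel_epi (T.dualStdIso a).inv]
    exact hom_ext_of_quot T.op.μ T.op.quotMap_surjective h
  have h3 : Function.Bijective ((T.biduality (T.std a)).app x).hom :=
    ⟨fun ξ ξ' h => by rw [← h1 ξ, h, h1], fun φ => ⟨E φ, h2 (h1 _)⟩⟩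
  exact (ConcreteCategory.isIso_iff_bijective _).2 h3

/-- The underlying left `C`-module of an object of `Cᵒᵖᵒᵖ_T-mod`. -/
def ofOpOp : T.op.op.Mod ⥤ C ⥤ ModuleCat.{w} k :=
  T.op.op.modProp.ι ⋙ (Functor.whiskeringLeft _ _ (ModuleCat.{w} k)).obj (opOp C)

instance : T.ofOpOp.Additive := by
  dsimp only [ofOpOp]
  infer_instance

instance : T.ofOpOp.Faithful := by
  dsimp only [ofOpOp]
  infer_instance

instance : T.ofOpOp.PreservesHomology :=
  have := T.op.op.modProp.ι.preservesFiniteLimits_of_preservesHomology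
  have := T.op.op.modProp.ι.preservesFiniteColimits_of_preservesHomology
  have : PreservesFiniteLimits T.ofOpOp := comp_preservesFiniteLimits _ _
  have : PreservesFiniteColimits T.ofOpOp := comp_preservesFiniteColimits _ _
  T.ofOpOp.preservesHomologyOfExact

/-- The bidual of a module, as a left `C`-module. -/
def bidual : T.Mod ⥤ C ⥤ ModuleCat.{w} k :=
  T.dual.rightOp ⋙ T.op.dual ⋙ T.ofOpOp

instance : T.bidual.Additive := by
  dsimp only [bidual]
  infer_instance

/-- The biduality morphism as a natural transformation. -/
def toBidual : T.modProp.ι ⟶ T.bidual where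
  app X := T.biduality X.obj
  naturality X Y φ := by
    ext x ξ
    apply (T.op.dualEquiv (T.dualObj Y.obj) _).injective
    refine (T.dualEquiv_biduality Y.obj _).trans
      (Eq.trans ?_ (T.op.dualEquiv_dual_map (T.dual.map φ.op) _ _).symm)
    refine Eq.trans ?_ (congrArg ((T.dual.map φ.op).hom ≫ ·)
      (T.dualEquiv_biduality X.obj ξ).symm)
    ext z N
    exact congr(($(T.dualEquiv_dual_map φ z N).app x).hom ξ).symm

variable {T}

/-- `D` is additive and reverses arrows, so the two families of a dual basis exchange roles. -/
lemma HasFiniteDualBasis.dual {X : T.Mod} (h : T.HasFiniteDualBasis X) :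
    T.op.HasFiniteDualBasis (T.dual.obj (Opposite.op X)) := by
  obtain ⟨m, a, i, p, hip⟩ := h
  let e (j : Fin m) : T.dual.obj (Opposite.op (T.stdObj (a j))) ≅ T.op.stdObj (Opposite.op (a j)) :=
    T.op.modProp.isoMk (T.dualStdIso (a j))
  refine ⟨m, fun j => Opposite.op (a j), fun j => T.dual.map (p j).op ≫ (e j).hom,
    fun j => (e j).inv ≫ T.dual.map (i j).op, ?_⟩
  have : T.dual.map (𝟙 X).op = 𝟙 _ := T.dual.map_id _
  rw [← this, ← hip, op_sum, Functor.map_sum]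
  simp

/-- A natural transformation of additive functors that is invertible on the `T_a` is invertible on
summands of their finite sums; the dual basis gives the inverse explicitly. -/
lemma HasFiniteDualBasis.isIso_toBidual {X : T.Mod} (h : T.HasFiniteDualBasis X) :
    IsIso (T.toBidual.app X) := by
  obtain ⟨m, a, i, p, hip⟩ := h
  have (j : Fin m) : IsIso (T.toBidual.app (T.stdObj (a j))) :=
    inferInstanceAs (IsIso (T.biduality (T.std (a j))))
  refine ⟨∑ j, T.bidual.map (i j) ≫ inv (T.toBidual.app (T.stdObj (a j))) ≫
    T.modProp.ι.map (p j), ?_, ?_⟩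
  · rw [Preadditive.comp_sum, ← T.modProp.ι.map_id, ← hip, Functor.map_sum]
    refine Finset.sum_congr rfl fun j _ => ?_
    rw [← NatTrans.naturality_assoc, IsIso.hom_inv_id_assoc, Functor.map_comp]
  · rw [Preadditive.sum_comp, ← T.bidual.map_id, ← hip, Functor.map_sum]
    refine Finset.sum_congr rfl fun j _ => ?_
    rw [Category.assoc, Category.assoc, NatTrans.naturality, IsIso.inv_hom_id_assoc,
      Functor.map_comp]

end YonedaBifunctor

/-! ### Dualizing finite resolutions -/

namespace YonedaBifunctor

variable {C : Type u} [Category.{w} C] {k : Type w} [CommRing k] (T : YonedaBifunctor C k)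
  [EssentiallySmall.{w} C]

variable {T} in
lemma nonempty_dualCohomology_iso {Z : CochainComplex T.Mod ℤ} {X : T.Mod}
    (hZ : Z.IsProjectiveResolution X) (i : ℤ) :
    Nonempty (T.dualCohomology i X ≅ (CochainComplex.reverse T.dual 0 Z).homology i) :=
  hZ.nonempty_homology_rightDerivedFunctorPlus_iso T.dual i

lemma isEilenbergMacLane_iff (n : ℤ) (F : T.Mod) :
    T.IsEilenbergMacLane n F ↔ ∀ i, i ≠ n → IsZero (T.dualCohomology i F) :=
  ⟨fun ⟨e⟩ i hi => (DerivedCategory.Plus.isZero_homology_single (T.dualCohomology n F) hi).of_iso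
      ((DerivedCategory.Plus.homologyFunctor T.op.Mod i).mapIso e),
    fun h => DerivedCategory.Plus.nonempty_iso_single (T.RDObj F) n h⟩

/-- The dual of a resolution of length `n` has no term in degree `n + 1`. -/
lemma isZero_dualCohomology_of_hasProjectiveDimensionLT (X : T.Mod) (n : ℕ)
    [HasProjectiveDimensionLT X (n + 1)] : IsZero (T.dualCohomology (n + 1 : ℕ) X) := by
  have hZ := (projectiveResolution X).isProjectiveResolution.truncGE n
  obtain ⟨e⟩ := nonempty_dualCohomology_iso hZ (n + 1 : ℕ)
  let Q := CochainComplex.reverse T.dual 0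
    ((projectiveResolution X).cochainComplex.truncGE (-n))
  have h : IsZero (Q.X (n + 1 : ℕ)) := T.dual.map_isZero
    (CochainComplex.isZero_of_isStrictlyGE _ (-n) (0 - (n + 1 : ℕ)) (by lia)).op
  have hQ : Q.ExactAt (n + 1 : ℕ) := ShortComplex.exact_of_isZero_X₂ (Q.sc (n + 1 : ℕ)) h
  exact hQ.isZero_homology.of_iso e

/-- A finite resolution of `X`, of length at most `n`, by projectives of finite type. -/
structure IsFiniteResolution (n : ℕ) (Z : CochainComplex T.Mod ℤ) (X : T.Mod) : Prop extends
    Z.IsProjectiveResolution X where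
  hasFiniteDualBasis (i : ℤ) : T.HasFiniteDualBasis (Z.X i)
  isStrictlyGE : Z.IsStrictlyGE (-n)

variable {T}

lemma IsTypeFP.exists_isFiniteResolution {F : T.Mod} (hF : T.IsTypeFP F) (n : ℕ)
    [HasProjectiveDimensionLT F (n + 1)] : ∃ Z, T.IsFiniteResolution n Z F := by
  obtain ⟨P, hP, -⟩ := hF
  have hZ := P.isProjectiveResolution
  have hft (i : ℤ) : T.IsFiniteType (P.cochainComplex.X i) := by
    by_cases hi : i ≤ 0
    · obtain ⟨j, rfl⟩ := Int.exists_eq_neg_ofNat hi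
      exact (hP j).of_epi (P.cochainComplexXIso (-j) j).inv
    · exact isFiniteType_of_isZero (hZ.isZero i (by lia))
  have hZ' := hZ.truncGE n
  refine ⟨_, hZ', fun i => ?_, inferInstance⟩
  have := hZ'.projective i
  -- Every term of the truncation, the syzygy included, is a quotient of a term of the original
  -- resolution.
  exact ((hft i).of_epi (HomologicalComplex.Hom.f
    (HomologicalComplex.πTruncGE P.cochainComplex _) i)).hasFiniteDualBasis

namespace IsFiniteResolution

variable {n : ℕ} {Z : CochainComplex T.Mod ℤ} {X : T.Mod}

lemma isTypeFP (hZ : T.IsFiniteResolution n Z X) : T.IsTypeFP X := by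
  obtain ⟨P, hP⟩ := hZ.exists_projectiveResolution
  have := hZ.isStrictlyGE
  refine ⟨P, fun i => ?_, n, fun i hi => ?_⟩
  · rw [hP]
    exact (hZ.hasFiniteDualBasis (-i)).isFiniteType
  · rw [hP]
    exact Z.isZero_of_isStrictlyGE (-n) (-i) (by lia)

/-- The vanishing makes `D(Z^j) ⟶ D(Z^i)` an epimorphism onto a projective. The dual of a section is
a retraction between biduals, carried back to `Z` by biduality. -/
lemma exists_retraction (hZ : T.IsFiniteResolution n Z X) (h : IsZero (T.dualCohomology n X))
    {i j : ℤ} (hi : -n = i) (hj : i + 1 = j) : ∃ r : Z.X j ⟶ Z.X i, Z.d i j ≫ r = 𝟙 _ := by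
  have := hZ.isStrictlyGE
  obtain ⟨e⟩ := nonempty_dualCohomology_iso hZ.toIsProjectiveResolution n
  obtain ⟨e'⟩ := CochainComplex.nonempty_reverse_homology_iso T.dual 0 Z n (i - 1) i j
  have hex : (CochainComplex.opSc T.dual Z (i - 1) i j).Exact := by
    rw [ShortComplex.exact_iff_isZero_homology]
    exact h.of_iso (e ≪≫ e').symm
  have hepi : Epi (T.dual.map (Z.d i j).op) :=
    (ShortComplex.exact_iff_epi _ ((T.dual.map_isZero
      (Z.isZero_of_isStrictlyGE (-n) (i - 1)).op).eq_of_tgt _ _)).1 hex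
  have := (hZ.hasFiniteDualBasis i).dual.projective
  let s := Projective.factorThru (𝟙 _) (T.dual.map (Z.d i j).op)
  have hs : s ≫ T.dual.map (Z.d i j).op = 𝟙 _ := Projective.factorThru_comp _ _
  let σ : T.bidual.obj (Z.X j) ⟶ T.bidual.obj (Z.X i) := T.ofOpOp.map (T.op.dual.map s.op)
  have hσ : T.bidual.map (Z.d i j) ≫ σ = 𝟙 _ := by
    refine (T.ofOpOp.map_comp (T.op.dual.map (T.dual.map (Z.d i j).op).op) _).symm.trans ?_
    rw [← T.op.dual.map_comp, ← op_comp, hs, op_id, T.op.dual.map_id, T.ofOpOp.map_id]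
    rfl
  have := (hZ.hasFiniteDualBasis i).isIso_toBidual
  refine ⟨T.modProp.ι.preimage (T.toBidual.app _ ≫ σ ≫ inv (T.toBidual.app _)),
    T.modProp.ι.map_injective ?_⟩
  rw [Functor.map_comp, Functor.map_preimage, NatTrans.naturality_assoc, reassoc_of% hσ,
    IsIso.hom_inv_id, T.modProp.ι.map_id]

lemma hasProjectiveDimensionLT (hZ : T.IsFiniteResolution n Z X)
    (h : IsZero (T.dualCohomology n X)) : HasProjectiveDimensionLT X n := by
  cases n with
  | zero =>
    -- Here `Z^1 = 0`, so the identity of `Z^0` factors through zero and `X` itself is zero.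
    obtain ⟨r, hr⟩ := hZ.exists_retraction h (i := 0) (j := 1) rfl rfl
    obtain ⟨e⟩ := hZ.nonempty_opcycles_iso
    have h0 : IsZero (Z.X 0) := by
      rw [IsZero.iff_id_eq_zero, ← hr, (hZ.isZero 1 (by lia)).eq_of_src r 0, comp_zero]
    have h1 : IsZero X :=
      IsZero.of_iso (by
        rw [IsZero.iff_id_eq_zero, ← cancel_epi (Z.pOpcycles 0)]
        exact h0.eq_of_src _ _) e.symm
    exact h1.hasProjectiveDimensionLT_zero
  | succ m =>
    obtain ⟨r, hr⟩ := hZ.exists_retraction h (j := -m) rfl (by lia)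
    have := hZ.projective (-m)
    -- The retraction splits the last syzygy sequence, so the `m`-th syzygy is already projective.
    have hr' : Z.fromOpcycles (-(m + 1 : ℕ)) (-m) ≫ r ≫ Z.pOpcycles _ = 𝟙 _ := by
      rw [← cancel_epi (Z.pOpcycles _), Z.p_fromOpcycles_assoc, reassoc_of% hr, Category.comp_id]
    have h1 : Projective (Z.opcycles (-m)) :=
      (Z.shortExact_opcycles (by lia) (hZ.exactAt (-(m + 1 : ℕ)) (by lia))).projective_X₃ _ hr'
    simpa using hZ.hasProjectiveDimensionLT_of_opcycles 0 m
      (projective_iff_hasProjectiveDimensionLT_one.1 h1)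

variable (hZ : T.IsFiniteResolution n Z X)
include hZ

lemma hasProjectiveDimensionLE : HasProjectiveDimensionLE X n := by
  have := hZ.isStrictlyGE
  have := hZ.projective (-n)
  have : IsIso (Z.pOpcycles (-n)) := Z.isIso_pOpcycles (-n - 1) (-n) (by simp)
    ((Z.isZero_of_isStrictlyGE (-n) (-n - 1)).eq_of_src _ _)
  have : Projective (Z.opcycles (-n)) := Projective.of_iso (asIso (Z.pOpcycles (-n))) inferInstance
  simpa using hZ.hasProjectiveDimensionLT_of_opcycles 0 n
    (projective_iff_hasProjectiveDimensionLT_one.1 this)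

/-- The term in degree `i` is `D(Z^(-n-i))`, so the complex again lives in degrees `-n, ..., 0`; its
cohomology in degree `i` is `D^(i+n)(X)`, which survives only for `i = 0`. -/
lemma reverse (h : T.IsEilenbergMacLane n X) :
    T.op.IsFiniteResolution n (CochainComplex.reverse T.dual (-n) Z) (T.dualCohomology n X) := by
  have hZn := hZ.isStrictlyGE
  have hb (i : ℤ) : T.op.HasFiniteDualBasis ((CochainComplex.reverse T.dual (-n) Z).X i) :=
    (hZ.hasFiniteDualBasis (-n - i)).dual
  have e (i j : ℤ) (hij : i + n = j) : Nonempty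
      ((CochainComplex.reverse T.dual (-n) Z).homology i ≅ T.dualCohomology j X) := by
    obtain ⟨e⟩ := nonempty_dualCohomology_iso hZ.toIsProjectiveResolution j
    obtain ⟨e1⟩ := CochainComplex.nonempty_reverse_homology_iso T.dual 0 Z j
      (-j - 1) (-j) (-j + 1)
    obtain ⟨e2⟩ := CochainComplex.nonempty_reverse_homology_iso T.dual (-n) Z i
      (-j - 1) (-j) (-j + 1)
    exact ⟨e2 ≪≫ e1.symm ≪≫ e.symm⟩
  refine ⟨⟨fun i => (hb i).projective, fun i hi => T.dual.map_isZero ?_, fun i hi => ?_,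
    e 0 n (by lia)⟩, hb, (CochainComplex.isStrictlyGE_iff _ _).2 fun i hi =>
      T.dual.map_isZero ?_⟩
  · exact (Z.isZero_of_isStrictlyGE (-n) (-n - i) (by lia)).op
  · rw [HomologicalComplex.exactAt_iff_isZero_homology]
    exact ((T.isEilenbergMacLane_iff n X).1 h (i + n) (by lia)).of_iso (e i _ rfl).some
  · exact (hZ.isZero (-n - i) (by lia)).op

/-- Dualizing twice gives `DDZ` shifted, with degree `i` corresponding to `i - n'`. Biduality
identifies it termwise with `Z`, compatibly with the differentials by naturality. -/
lemma nonempty_bidual_homology_iso (n' i j : ℤ) (hj : -n' - -i = j) :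
    Nonempty (opOp C ⋙ ((CochainComplex.reverse T.op.dual 0
      (CochainComplex.reverse T.dual (-n') Z)).homology i).obj ≅ (Z.homology j).obj) := by
  subst hj
  let Q := CochainComplex.reverse T.dual (-n') Z
  obtain ⟨e⟩ := CochainComplex.nonempty_reverse_homology_iso T.op.dual 0 Q i (-i - 1) (-i) (-i + 1)
  let S := CochainComplex.opSc T.op.dual Q (-i - 1) (-i) (-i + 1)
  let S' := Z.sc' (-n' - (-i + 1)) (-n' - -i) (-n' - (-i - 1))
  have h (l : ℤ) : IsIso (T.toBidual.app (Z.X l)) := (hZ.hasFiniteDualBasis l).isIso_toBidual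
  let b (l : ℤ) : T.modProp.ι.obj (Z.X l) ≅ T.bidual.obj (Z.X l) := asIso (T.toBidual.app (Z.X l))
  let α : S'.map T.modProp.ι ≅ S.map T.ofOpOp :=
    ShortComplex.isoMk (b _) (b _) (b _) (T.toBidual.naturality _).symm
      (T.toBidual.naturality _).symm
  let e' : S'.homology ≅ Z.homology (-n' - -i) :=
    (Z.homologyIsoSc' (-n' - (-i + 1)) (-n' - -i) (-n' - (-i - 1)) (by simp; lia)
      (by simp; lia)).symm
  exact ⟨T.ofOpOp.mapIso e ≪≫ (S.mapHomologyIso T.ofOpOp).symm ≪≫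
    (ShortComplex.homologyMapIso α).symm ≪≫ S'.mapHomologyIso T.modProp.ι ≪≫
      T.modProp.ι.mapIso e'⟩

lemma nonempty_bidual_iso (h : T.IsEilenbergMacLane n X) :
    Nonempty (opOp C ⋙ (T.op.dualCohomology n (T.dualCohomology n X)).obj ≅ X.obj) := by
  obtain ⟨e⟩ := nonempty_dualCohomology_iso (hZ.reverse h).toIsProjectiveResolution n
  obtain ⟨e1⟩ := hZ.nonempty_bidual_homology_iso n n 0 (by lia)
  exact ⟨T.ofOpOp.mapIso e ≪≫ e1 ≪≫ T.modProp.ι.mapIso hZ.nonempty_iso.some⟩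

lemma isEilenbergMacLane_dualCohomology (h : T.IsEilenbergMacLane n X) :
    T.op.IsEilenbergMacLane n (T.dualCohomology n X) := by
  rw [isEilenbergMacLane_iff]
  intro i hi
  obtain ⟨e⟩ := nonempty_dualCohomology_iso (hZ.reverse h).toIsProjectiveResolution i
  obtain ⟨e1⟩ := hZ.nonempty_bidual_homology_iso n i (-n - -i) rfl
  have h1 : IsZero (Z.homology (-n - -i)) := (hZ.exactAt _ (by lia)).isZero_homology
  have h2 : IsZero (T.ofOpOp.obj (T.op.dualCohomology i (T.dualCohomology n X))) :=
    (T.modProp.ι.map_isZero h1).of_iso (T.ofOpOp.mapIso e ≪≫ e1)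
  -- The faithful additive functor `ofOpOp` reflects zero objects.
  rw [IsZero.iff_id_eq_zero]
  exact T.ofOpOp.map_injective (h2.eq_of_src _ _)

end IsFiniteResolution

end YonedaBifunctor

end

theorem mainTheorem11 {C : Type u} [Category.{w} C] [EssentiallySmall.{w} C]
    {k : Type w} [CommRing k] (T : YonedaBifunctor C k) (F : T.Mod)
    (hF : T.IsDualityFunctor F) (n : ℕ) (hn : projectiveDimension F = n) :
    T.op.IsDualityFunctor (T.dualCohomology n F) ∧
      projectiveDimension (T.dualCohomology n F) = n ∧
      Nonempty (opOp C ⋙ (T.op.dualCohomology n (T.dualCohomology n F)).obj ≅ F.obj) := by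
  have h1 : HasProjectiveDimensionLT F (n + 1) := (projectiveDimension_le_iff F n).1 hn.le
  -- For `n = 0` this says that `F` is nonzero.
  have h2 : ¬ HasProjectiveDimensionLT F n := (projectiveDimension_ge_iff F n).1 hn.ge
  obtain ⟨Z, hZ⟩ := hF.1.exists_isFiniteResolution n
  have h3 : ¬ IsZero (T.dualCohomology n F) := fun h => h2 (hZ.hasProjectiveDimensionLT h)
  -- The degree `m` in the definition must be `n`, since `D^n(F)` is nonzero.
  have hEM : T.IsEilenbergMacLane n F := by
    obtain ⟨m, hm⟩ := hF.2
    by_cases hmn : (n : ℤ) = m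
    · exact hmn ▸ hm
    · exact (h3 ((T.isEilenbergMacLane_iff m F).1 hm n hmn)).elim
  have hQ := hZ.reverse hEM
  have hb := hZ.nonempty_bidual_iso hEM
  refine ⟨⟨hQ.isTypeFP, n, hZ.isEilenbergMacLane_dualCohomology hEM⟩, le_antisymm ?_ ?_, hb⟩
  · rw [projectiveDimension_le_iff]
    exact hQ.hasProjectiveDimensionLE
  · rw [projectiveDimension_ge_iff]
    intro h
    obtain _ | m := n
    -- Projective dimension less than `0` would mean `D^0(F) = 0`.
    · exact h3 (isZero_of_hasProjectiveDimensionLT_zero _)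
    -- A smaller projective dimension would kill the top dual cohomology of `D^n(F)`, which is `F`.
    · have h4 := T.op.isZero_dualCohomology_of_hasProjectiveDimensionLT
        (T.dualCohomology (m + 1 : ℕ) F) m
      have h5 : IsZero (T.modProp.ι.obj F) := (T.ofOpOp.map_isZero h4).of_iso hb.some.symm
      have h6 : IsZero F := by
        rw [IsZero.iff_id_eq_zero]
        exact T.modProp.ι.map_injective (h5.eq_of_src _ _)
      have := h6.hasProjectiveDimensionLT_zero
      exact h2 (hasProjectiveDimensionLT_of_ge F 0 _ (by lia))
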